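/- Let $J\ge 1$ and $d\ge 0$ be integers, let $\lambda_0,\dots,\lambda_{J-1}\ge 0$ with $\sum_j\lambda_j=1$, and for $x=(x_0,\dots,x_{J-1})\in(\mathbb R^d)^J$ put $$c(x)=\frac12\sum_{i,j=0}^{J-1}\lambda_i\lambda_j\|x_i-x_j\|^2=\sum_{i=0}^{J-1}\lambda_i\Big\|x_i-\sum_{j}\lambda_jx_j\Big\|^2 .$$ For probability measures $\nu_0,\dots,\nu_{J-1}$ on $\mathbb R^d$ let $\Pi(\nu_0,\dots,\nu_{J-1})$ be the set of probability measures on $(\mathbb R^d)^J$ with marginals $\nu_0,\dots,\nu_{J-1}$, and let $mmW_2^2(\nu_0,\dots,\nu_{J-1})=\inf_{\gamma\in\Pi(\nu_0,\dots,\nu_{J-1})}\int c\,d\gamma$; a $\gamma$ attaining this infimum is called an optimal multi-marginal plan. A finite Gaussian mixture is a convex combination of finitely many (possibly degenerate) Gaussian probability measures. Let $MMW_2^2(\nu_0,\dots,\nu_{J-1})$ be the infimum of $\int c\,d\gamma$ over those $\gamma\in\Pi(\nu_0,\dots,\nu_{J-1})$ that are finite Gaussian mixtures on $(\mathbb R^d)^J$.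 For each $j$ let $\mu_j=\sum_{k=1}^{K_j}\pi_j^k\mu_j^k$, where the $\mu_j^k$ are (possibly degenerate) Gaussian measures on $\mathbb R^d$, $\pi_j^k\ge 0$ and $\sum_k\pi_j^k=1$. Let $\Pi(\pi_0,\dots,\pi_{J-1})$ be the set of nonnegative tensors $w=(w_{k_0\dots k_{J-1}})_{1\le k_j\le K_j}$ such that $\sum_{k_0,\dots,k_{J-1}:\,k_j=k}w_{k_0\dots k_{J-1}}=\pi_j^k$ for all $j$ and $k$. Then: 1. $MMW_2^2(\mu_0,\dots,\mu_{J-1})$ is finite and $$MMW_2^2(\mu_0,\dots,\mu_{J-1})=\min_{w\in\Pi(\pi_0,\dots,\pi_{J-1})}\ \sum_{k_0,\dots,k_{J-1}}w_{k_0\dots k_{J-1}}\,mmW_2^2(\mu_0^{k_0},\dots,\mu_{J-1}^{k_{J-1}}),$$ the minimum on the right being attained. 2. For all $k_0,\dots,k_{J-1}$ there is an optimal multi-marginal plan between $\mu_0^{k_0},\dots,\mu_{J-1}^{k_{J-1}}$ that is Gaussian. If $w^*$ is any minimizer of the discrete problem and $\gamma^*_{k_0\dots k_{J-1}}$ are any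 such Gaussian optimal plans, then $$\gamma^*=\sum_{k_0,\dots,k_{J-1}}w^*_{k_0\dots k_{J-1}}\gamma^*_{k_0\dots k_{J-1}}$$ is a finite Gaussian mixture in $\Pi(\mu_0,\dots,\mu_{J-1})$ that attains the infimum defining $MMW_2^2(\mu_0,\dots,\mu_{J-1})$. 3. Conversely, every $\gamma^*$ attaining the infimum defining $MMW_2^2(\mu_0,\dots,\mu_{J-1})$ can be written in this form, where $w^*$ is a minimizer of the discrete problem and each $\gamma^*_{k_0\dots k_{J-1}}$ is an optimal multi-marginal plan between $\mu_0^{k_0},\dots,\mu_{J-1}^{k_{J-1}}$ that is a finite Gaussian mixture. -/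

import Mathlib

open MeasureTheory ProbabilityTheory
open scoped NNReal ENNReal

noncomputable section

namespace GMMOT

/-- `ℝ^d` with its Euclidean norm. -/
abbrev Rd (d : ℕ) : Type := EuclideanSpace ℝ (Fin d)

/-- The finite mixture `∑ₖ πₖ μₖ` of a family of measures. -/
def mixture {ι E : Type*} [Fintype ι] [MeasurableSpace E] (p : ι → ℝ≥0) (μ : ι → Measure E) :
    Measure E :=
  ∑ k, p k • μ k

/-- `μ` is a finite Gaussian mixture: `μ = ∑ₖ πₖ μₖ` with `π` in the simplex and every `μₖ` a
(possibly degenerate) Gaussian probability measure. -/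
def IsGMM {E : Type*} [TopologicalSpace E] [AddCommMonoid E] [Module ℝ E] [MeasurableSpace E]
    (μ : Measure E) : Prop :=
  ∃ (K : ℕ) (p : Fin K → ℝ≥0) (ν : Fin K → Measure E),
    ∑ k, p k = 1 ∧ (∀ k, IsGaussian (ν k)) ∧ μ = mixture p ν

/-- `Π(μ₀, …, μ_{J-1})`: probability measures on `(ℝ^d)^J` with marginals `μ₀, …, μ_{J-1}`. -/
def couplings {J d : ℕ} (μ : Fin J → Measure (Rd d)) : Set (Measure (Fin J → Rd d)) :=
  {γ | IsProbabilityMeasure γ ∧ ∀ j, γ.map (fun x => x j) = μ j}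

/-- The weighted barycenter `B(x) = ∑ᵢ λᵢ xᵢ`. -/
def bary {J d : ℕ} (lam : Fin J → ℝ) (x : Fin J → Rd d) : Rd d := ∑ i, lam i • x i

/-- The cost `c(x) = ½ ∑ᵢⱼ λᵢ λⱼ ‖xᵢ - xⱼ‖²`. -/
def cost {J d : ℕ} (lam : Fin J → ℝ) (x : Fin J → Rd d) : ℝ :=
  (1 / 2) * ∑ i, ∑ j, lam i * lam j * ‖x i - x j‖ ^ 2

/-- For weights summing to one, the cost is also `∑ᵢ λᵢ ‖xᵢ - B(x)‖²`. -/
theorem cost_eq_sum_bary {J d : ℕ} (lam : Fin J → ℝ) (hsum : ∑ j, lam j = 1)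
    (x : Fin J → Rd d) : cost lam x = ∑ i, lam i * ‖x i - bary lam x‖ ^ 2 := by
  have hB : ∀ y : Rd d, inner ℝ y (bary lam x) = ∑ j, lam j * inner ℝ y (x j) := by
    intro y
    simp [bary, inner_sum, inner_smul_right]
  have hBB : inner ℝ (bary lam x) (bary lam x) = ∑ i, lam i * inner ℝ (x i) (bary lam x) := by
    rw [hB]
    exact Finset.sum_congr rfl fun i _ => by rw [real_inner_comm]
  have h1 : ∀ i, lam i * ‖x i - bary lam x‖ ^ 2 = lam i * ‖x i‖ ^ 2
      - 2 * (lam i * inner ℝ (x i) (bary lam x)) + lam i * ‖bary lam x‖ ^ 2 := by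
    intro i
    rw [norm_sub_sq_real]
    ring
  have h2 : ∀ i, ∑ j, lam i * lam j * ‖x i - x j‖ ^ 2 = lam i * ‖x i‖ ^ 2
      - 2 * (lam i * inner ℝ (x i) (bary lam x)) + lam i * ∑ j, lam j * ‖x j‖ ^ 2 := by
    intro i
    have : ∀ j, lam i * lam j * ‖x i - x j‖ ^ 2 = lam j * (lam i * ‖x i‖ ^ 2)
        - 2 * lam i * (lam j * inner ℝ (x i) (x j)) + lam i * (lam j * ‖x j‖ ^ 2) := by
      intro j
      rw [norm_sub_sq_real]
      ring
    simp only [this, Finset.sum_add_distrib, Finset.sum_sub_distrib, ← Finset.mul_sum,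
      ← Finset.sum_mul, hsum, hB]
    ring
  rw [cost]
  simp only [h1, h2, Finset.sum_add_distrib, Finset.sum_sub_distrib, ← Finset.mul_sum,
    ← Finset.sum_mul, hsum, ← hBB, real_inner_self_eq_norm_sq]
  ring

/-- The transport cost `∫ c dγ ∈ [0, ∞]` of a plan (the cost is nonnegative when `λ ≥ 0`). -/
def planCost {J d : ℕ} (lam : Fin J → ℝ) (γ : Measure (Fin J → Rd d)) : ℝ≥0∞ :=
  ∫⁻ x, ENNReal.ofReal (cost lam x) ∂γ

/-- `mmW₂²(μ₀, …, μ_{J-1})`: infimum of the transport cost over all couplings. -/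
def mmW2sq {J d : ℕ} (lam : Fin J → ℝ) (μ : Fin J → Measure (Rd d)) : ℝ≥0∞ :=
  ⨅ γ ∈ couplings μ, planCost lam γ

/-- `MMW₂²(μ₀, …, μ_{J-1})`: infimum of the transport cost over couplings that are finite
Gaussian mixtures on `(ℝ^d)^J`. -/
def MMW2sq {J d : ℕ} (lam : Fin J → ℝ) (μ : Fin J → Measure (Rd d)) : ℝ≥0∞ :=
  ⨅ γ ∈ couplings μ ∩ {γ | IsGMM γ}, planCost lam γ

/-- `γ` is an optimal plan for `mmW₂²(μ₀, …, μ_{J-1})`. -/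
def IsOptimalPlan {J d : ℕ} (lam : Fin J → ℝ) (μ : Fin J → Measure (Rd d))
    (γ : Measure (Fin J → Rd d)) : Prop :=
  γ ∈ couplings μ ∧ planCost lam γ = mmW2sq lam μ

/-- `γ` is a solution of the problem `MMW₂²(μ₀, …, μ_{J-1})`. -/
def IsOptimalGMMPlan {J d : ℕ} (lam : Fin J → ℝ) (μ : Fin J → Measure (Rd d))
    (γ : Measure (Fin J → Rd d)) : Prop :=
  γ ∈ couplings μ ∧ IsGMM γ ∧ planCost lam γ = MMW2sq lam μ

/-- `Π(π₀, …, π_{J-1})`: nonnegative tensors of size `K₀ × ⋯ × K_{J-1}` with discrete marginals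
`π₀, …, π_{J-1}`. -/
def tensorCouplings {J : ℕ} {K : Fin J → ℕ} (p : ∀ j, Fin (K j) → ℝ≥0) :
    Set ((∀ j, Fin (K j)) → ℝ≥0) :=
  {w | ∀ (j : Fin J) (k : Fin (K j)), ∑ κ with κ j = k, w κ = p j k}

/-- The objective `∑ w_{k₀…k_{J-1}} mmW₂²(μ₀^{k₀}, …, μ_{J-1}^{k_{J-1}})` of the discrete
multi-marginal linear program. -/
def discreteCost {J d : ℕ} {K : Fin J → ℕ} (lam : Fin J → ℝ)
    (comp : ∀ j, Fin (K j) → Measure (Rd d)) (w : (∀ j, Fin (K j)) → ℝ≥0) : ℝ≥0∞ :=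
  ∑ κ, (w κ : ℝ≥0∞) * mmW2sq lam (fun j => comp j (κ j))

/-- `w` is a solution of the discrete multi-marginal linear program. -/
def IsOptimalTensor {J d : ℕ} {K : Fin J → ℕ} (lam : Fin J → ℝ) (p : ∀ j, Fin (K j) → ℝ≥0)
    (comp : ∀ j, Fin (K j) → Measure (Rd d)) (w : (∀ j, Fin (K j)) → ℝ≥0) : Prop :=
  w ∈ tensorCouplings p ∧
    ∀ w' ∈ tensorCouplings p, discreteCost lam comp w ≤ discreteCost lam comp w'

end GMMOT

end

/-!
The cost of a coupling depends only on its mean and covariance matrix. The covariance matrices of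
couplings with prescribed Gaussian marginals lie in the compact set of positive semidefinite
matrices with prescribed diagonal blocks, so the cost has a minimizer there, and a Gaussian measure
realizes it: Gaussian marginals have Gaussian optimal plans.

Pairwise distinct Gaussian measures are linearly independent: a generic linear form keeps finitely
many of them distinct, and the moment generating functions `exp (m t + v t² / 2)` of distinct real
Gaussian laws grow at different rates. Hence the marginals of the Gaussian components of a mixture
coupling are, with the right total weights, the given components. Splitting the weight of each
component of the coupling according to the conditional weights of equal marginal components writes
the coupling as a mixture of couplings of component tuples, indexed by a tensor with marginals `πⱼ`.
Its cost is therefore at least the discrete cost of that tensor, and mixing optimal plans attains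
this bound.
-/

namespace GMMOT

/-! ### Linear independence of Gaussian measures -/

open Asymptotics Filter in
theorem linearIndependent_of_isLittleO {𝕜 α ι F : Type*} [NormedField 𝕜] [NormedAddCommGroup F]
    [NormedSpace 𝕜 F] [LinearOrder ι] {l : Filter α} {g : ι → α → F}
    (hne : ∀ i, ∃ᶠ x in l, g i x ≠ 0) (hlt : ∀ i j, i < j → g i =o[l] g j) :
    LinearIndependent 𝕜 g := by
  classical
  rw [linearIndependent_iff']
  intro s c hsum
  by_contra! hc
  let t := s.filter (c · ≠ 0)
  have ht : t.Nonempty := by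
    obtain ⟨i, hi, hci⟩ := hc
    exact ⟨i, Finset.mem_filter.mpr ⟨hi, hci⟩⟩
  have hmax := t.max'_mem ht
  have hcmax : c (t.max' ht) ≠ 0 := (Finset.mem_filter.mp hmax).2
  have hdominant : c (t.max' ht) • g (t.max' ht) = -∑ i ∈ t.erase (t.max' ht), c i • g i := by
    rw [eq_neg_iff_add_eq_zero, Finset.add_sum_erase t (fun i => c i • g i) hmax, ← hsum]
    exact Finset.sum_filter_of_ne fun i _ h hci => h (by rw [hci, zero_smul])
  have hsmall : (c (t.max' ht) • g (t.max' ht)) =o[l] g (t.max' ht) := by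
    rw [hdominant]
    refine (IsLittleO.sum fun i hi => ?_).neg_left
    exact (hlt i _ (t.lt_max'_of_mem_erase_max' ht hi)).const_smul_left (c i)
  exact isLittleO_irrefl (hne _) ((isLittleO_const_smul_left hcmax).mp hsmall)

theorem linearIndependent_exp_quadratic :
    LinearIndependent ℝ fun (x : ℝ ×ₗ ℝ) (t : ℝ) =>
      Real.exp ((ofLex x).1 * t ^ 2 + (ofLex x).2 * t) := by
  refine linearIndependent_of_isLittleO (l := Filter.atTop)
    (fun _ => .of_forall fun _ => Real.exp_ne_zero _) fun x y hxy => ?_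
  rw [Real.isLittleO_exp_comp_exp_comp]
  rcases Prod.Lex.lt_iff.mp hxy with h | ⟨h, h'⟩
  · have hlin : Filter.Tendsto (fun t : ℝ => ((ofLex y).1 - (ofLex x).1) * t +
        ((ofLex y).2 - (ofLex x).2)) Filter.atTop Filter.atTop :=
      Filter.tendsto_atTop_add_const_right _ _
        (Filter.tendsto_id.const_mul_atTop (sub_pos.mpr h))
    refine (Filter.tendsto_id.atTop_mul_atTop₀ hlin).congr fun t => ?_
    simp only [id]
    ring
  · refine (Filter.tendsto_id.const_mul_atTop (sub_pos.mpr h')).congr fun t => ?_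
    simp only [id, h]
    ring

theorem linearIndependent_gaussianReal :
    LinearIndependent ℝ≥0 fun x : ℝ × ℝ≥0 => gaussianReal x.1 x.2 := by
  let index : ℝ × ℝ≥0 → ℝ ×ₗ ℝ := fun x => toLex ((x.2 : ℝ) / 2, x.1)
  have hindex : Function.Injective index := fun x y hxy => by
    simp only [index, toLex_inj, Prod.mk.injEq] at hxy
    exact Prod.ext hxy.2 (NNReal.coe_injective (by linarith))
  have hmgf (s : Finset (ℝ × ℝ≥0)) (c : ℝ × ℝ≥0 → ℝ≥0) (t : ℝ) :
      mgf id (∑ x ∈ s, c x • gaussianReal x.1 x.2) t =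
        ∑ x ∈ s, (c x : ℝ) * Real.exp ((x.2 : ℝ) / 2 * t ^ 2 + x.1 * t) := by
    simp only [mgf, id]
    rw [integral_finsetSum_measure fun x _ =>
      (integrable_exp_mul_gaussianReal t).smul_measure_nnreal]
    refine Finset.sum_congr rfl fun x _ => ?_
    rw [integral_smul_nnreal_measure, NNReal.smul_def, smul_eq_mul]
    congr 1
    refine (mgf_gaussianReal Measure.map_id t).trans ?_
    ring_nf
  rw [linearIndependent_iff'ₛ]
  intro s a b hab x hx
  refine NNReal.coe_injective (linearIndependent_iff'ₛ.mp
    (linearIndependent_exp_quadratic.comp index hindex) s (fun x => (a x : ℝ)) (fun x => (b x : ℝ))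
    ?_ x hx)
  ext t
  simpa [hmgf, index] using congrArg (mgf id · t) hab

section Identifiability

variable {E : Type*} [NormedAddCommGroup E] [NormedSpace ℝ E] [MeasurableSpace E] [BorelSpace E]
  [CompleteSpace E] [SecondCountableTopology E]

theorem map_eq_map_iff_of_isGaussian {ρ σ : Measure E} [IsGaussian ρ] [IsGaussian σ]
    (L : StrongDual ℝ E) :
    ρ.map L = σ.map L ↔ L (∫ x, x ∂ρ) = L (∫ x, x ∂σ) ∧
      covarianceBilinDual ρ L L = covarianceBilinDual σ L L := by
  simp only [covarianceBilinDual_self_eq_variance IsGaussian.memLp_two_id,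
    IsGaussian.map_eq_gaussianReal, IsGaussian.integral_dual]
  refine gaussianReal_ext_iff.trans (and_congr_right fun _ => ?_)
  exact Real.toNNReal_eq_toNNReal_iff (variance_nonneg _ _) (variance_nonneg _ _)

theorem eq_of_forall_map_dual_eq {ρ σ : Measure E} [IsFiniteMeasure ρ] [IsFiniteMeasure σ]
    (h : ∀ L : StrongDual ℝ E, ρ.map L = σ.map L) : ρ = σ := by
  refine Measure.ext_of_charFunDual (funext fun L => ?_)
  rw [charFunDual_eq_charFun_map_one, charFunDual_eq_charFun_map_one, h L]

-- The linear forms that fail to separate two measures are the zeros of a nonzero analytic function.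
theorem isOpen_dense_setOf_map_ne {ρ σ : Measure E} [IsGaussian ρ] [IsGaussian σ] (hne : ρ ≠ σ) :
    IsOpen {L : StrongDual ℝ E | ρ.map L ≠ σ.map L} ∧
      Dense {L : StrongDual ℝ E | ρ.map L ≠ σ.map L} := by
  let gap (L : StrongDual ℝ E) : ℝ := (L (∫ x, x ∂ρ) - L (∫ x, x ∂σ)) ^ 2 +
    (covarianceBilinDual ρ L L - covarianceBilinDual σ L L) ^ 2
  have hgap (L : StrongDual ℝ E) : gap L = 0 ↔ ρ.map L = σ.map L := by
    rw [map_eq_map_iff_of_isGaussian, add_eq_zero_iff_of_nonneg (sq_nonneg _) (sq_nonneg _),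
      sq_eq_zero_iff, sq_eq_zero_iff, sub_eq_zero, sub_eq_zero]
  have hsmooth : ContDiff ℝ ⊤ gap := by fun_prop
  have hset : {L : StrongDual ℝ E | ρ.map L ≠ σ.map L} = {L | gap L = 0}ᶜ := by
    ext L
    simp [hgap]
  rw [hset]
  refine ⟨(isClosed_eq hsmooth.continuous continuous_const).isOpen_compl,
    interior_eq_empty_iff_dense_compl.mp ?_⟩
  by_contra! hint
  obtain ⟨L₀, hL₀⟩ := hint
  have hzero : gap = 0 := AnalyticOnNhd.eq_of_eventuallyEq hsmooth.analyticOnNhd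
    analyticOnNhd_const (mem_interior_iff_mem_nhds.mp hL₀)
  exact hne (eq_of_forall_map_dual_eq fun L => (hgap L).mp (congrFun hzero L))

theorem exists_dual_separating {ι : Type*} [Countable ι] {ρ : ι → Measure E}
    (hρ : ∀ i, IsGaussian (ρ i)) :
    ∃ L : StrongDual ℝ E, ∀ i j, (ρ i).map L = (ρ j).map L → ρ i = ρ j := by
  have hdense := dense_iInter_of_isOpen
    (fun q : {q : ι × ι // ρ q.1 ≠ ρ q.2} => (isOpen_dense_setOf_map_ne q.2).1)
    (fun q => (isOpen_dense_setOf_map_ne q.2).2)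
  obtain ⟨L, hL⟩ := hdense.nonempty
  exact ⟨L, fun i j hij => by_contra fun hne => Set.mem_iInter.mp hL ⟨(i, j), hne⟩ hij⟩

theorem linearIndepOn_isGaussian : LinearIndepOn ℝ≥0 id {ρ : Measure E | IsGaussian ρ} := by
  rw [LinearIndepOn, linearIndependent_iff_finset_linearIndependent]
  intro s
  obtain ⟨L, hL⟩ := exists_dual_separating (ρ := fun ρ : s => (ρ : Measure E)) fun ρ => ρ.1.2
  let params (ρ : s) : ℝ × ℝ≥0 := (∫ x, L x ∂(ρ : Measure E), Var[L; (ρ : Measure E)].toNNReal)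
  have hmap (ρ : s) : (ρ : Measure E).map L = gaussianReal (params ρ).1 (params ρ).2 :=
    have : IsGaussian (ρ : Measure E) := ρ.1.2
    IsGaussian.map_eq_gaussianReal L
  have hparams : Function.Injective params := fun ρ σ h =>
    Subtype.ext (Subtype.ext (hL ρ σ (by rw [hmap, hmap, h])))
  refine LinearIndependent.of_comp ((Measure.mapₗ L).restrictScalars ℝ≥0) ?_
  convert linearIndependent_gaussianReal.comp params hparams using 1
  ext1 ρ
  exact (Measure.mapₗ_apply_of_measurable L.continuous.measurable _).trans (hmap ρ)

end Identifiability

section FiberWeight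

open Classical in
/-- The total weight `∑ pᵢ` over the fiber `fᵢ = x`: the mass at `x` of the pushforward under `f` of
the discrete measure with weights `p`. -/
noncomputable def fiberWeight {ι X : Type*} [Fintype ι] (f : ι → X) (p : ι → ℝ≥0) (x : X) : ℝ≥0 :=
  ∑ i with f i = x, p i

theorem fiberWeight_eq_finsuppSum {ι X : Type*} [Fintype ι] (f : ι → X) (p : ι → ℝ≥0) :
    fiberWeight f p = ⇑(∑ i, Finsupp.single (f i) (p i)) := by
  classical
  ext x
  simp [fiberWeight, Finsupp.finsetSum_apply, Finsupp.single_apply, Finset.sum_filter]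

theorem fiberWeight_eq_of_mixture_eq {ι ι' E : Type*} [Fintype ι] [Fintype ι']
    [MeasurableSpace E] {S : Set (Measure E)} (hS : LinearIndepOn ℝ≥0 id S)
    {p : ι → ℝ≥0} {q : ι' → ℝ≥0} {μ : ι → Measure E} {ν : ι' → Measure E}
    (hμ : ∀ i, μ i ∈ S) (hν : ∀ i, ν i ∈ S) (h : mixture p μ = mixture q ν) :
    fiberWeight μ p = fiberWeight ν q := by
  rw [fiberWeight_eq_finsuppSum, fiberWeight_eq_finsuppSum]
  congr 1
  refine linearIndepOn_iffₛ.mp hS _ ?_ _ ?_ ?_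
  · exact sum_mem fun i _ => Finsupp.single_mem_supported _ _ (hμ i)
  · exact sum_mem fun i _ => Finsupp.single_mem_supported _ _ (hν i)
  · simpa [mixture] using h

end FiberWeight

/-! ### Gaussian optimal plans -/

section Moments

variable {Ω : Type*} [MeasurableSpace Ω] {P : Measure Ω}

theorem integral_sub_sq_eq [IsProbabilityMeasure P] {X Y : Ω → ℝ} (hX : MemLp X 2 P)
    (hY : MemLp Y 2 P) :
    ∫ ω, (X ω - Y ω) ^ 2 ∂P =
      (∫ ω, X ω ∂P - ∫ ω, Y ω ∂P) ^ 2 + (cov[X, X; P] - 2 * cov[X, Y; P] + cov[Y, Y; P]) := by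
  have hvar := variance_eq_sub (hX.sub hY)
  rw [variance_sub hX hY,
    integral_sub' (hX.integrable one_le_two) (hY.integrable one_le_two)] at hvar
  simp only [Pi.pow_apply, Pi.sub_apply] at hvar
  rw [covariance_self hX.aemeasurable, covariance_self hY.aemeasurable, hvar]
  ring

variable {ι : Type*}

/-- The covariance matrix of a family of real random variables. -/
noncomputable def covarianceMatrix (X : ι → Ω → ℝ) (P : Measure Ω) : Matrix ι ι ℝ :=
  Matrix.of fun i j => cov[X i, X j; P]

theorem posSemidef_covarianceMatrix [Finite ι] [IsFiniteMeasure P] {X : ι → Ω → ℝ}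
    (hX : ∀ i, MemLp (X i) 2 P) : (covarianceMatrix X P).PosSemidef := by
  have := Fintype.ofFinite ι
  refine .of_dotProduct_mulVec_nonneg ?_ fun x => ?_
  · ext i j
    exact covariance_comm (X j) (X i)
  · have hquad := covarianceBilin_apply_pi hX (WithLp.toLp 2 x) (WithLp.toLp 2 x)
    refine (covarianceBilin_self_nonneg _).trans_eq (hquad.trans ?_)
    simp only [dotProduct, Matrix.mulVec, Finset.mul_sum, covarianceMatrix, Matrix.of_apply,
      star_trivial]
    exact Finset.sum_congr rfl fun _ _ => Finset.sum_congr rfl fun _ _ => by ring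

theorem covarianceBilin_eq_sum_cov [Fintype ι] {μ : Measure (EuclideanSpace ℝ ι)}
    [IsFiniteMeasure μ] (hμ : MemLp id 2 μ) (x y : EuclideanSpace ℝ ι) :
    covarianceBilin μ x y = ∑ a, ∑ b, x a * y b * cov[fun z => z a, fun z => z b; μ] := by
  simpa using covarianceBilin_apply_pi (fun a => hμ.eval_piLp a) x y

theorem integral_apply_of_memLp [Fintype ι] {μ : Measure (EuclideanSpace ℝ ι)} [IsFiniteMeasure μ]
    (hμ : MemLp id 2 μ) (a : ι) : (∫ z, z ∂μ) a = ∫ z, z a ∂μ :=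
  eval_integral_piLp (f := id) (fun b => (hμ.eval_piLp b).integrable one_le_two) a

theorem eq_of_isGaussian_of_moments_eq [Finite ι] {μ ν : Measure (EuclideanSpace ℝ ι)}
    [IsGaussian μ] [IsGaussian ν] (hmean : ∀ a, ∫ z, z a ∂μ = ∫ z, z a ∂ν)
    (hcov : ∀ a b, cov[fun z => z a, fun z => z b; μ] = cov[fun z => z a, fun z => z b; ν]) :
    μ = ν := by
  have := Fintype.ofFinite ι
  have hμ : MemLp id 2 μ := IsGaussian.memLp_two_id
  have hν : MemLp id 2 ν := IsGaussian.memLp_two_id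
  refine IsGaussian.ext ?_ ?_
  · ext a
    exact (integral_apply_of_memLp hμ a).trans ((hmean a).trans (integral_apply_of_memLp hν a).symm)
  · ext x y
    simp only [covarianceBilin_eq_sum_cov hμ, covarianceBilin_eq_sum_cov hν, hcov]

end Moments

section PosSemidef

variable {n : Type*} [Finite n]

theorem abs_apply_le_of_posSemidef {S : Matrix n n ℝ} (hS : S.PosSemidef) (i j : n) :
    |S i j| ≤ (S i i + S j j) / 2 := by
  classical
  have := Fintype.ofFinite n
  have hsymm : S j i = S i j := hS.isHermitian.apply i j
  have hadd := hS.dotProduct_mulVec_nonneg (Pi.single i 1 + Pi.single j 1)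
  have hsub := hS.dotProduct_mulVec_nonneg (Pi.single i 1 - Pi.single j 1)
  simp only [star_trivial, Matrix.mulVec_add, Matrix.mulVec_sub, add_dotProduct, sub_dotProduct,
    dotProduct_add, dotProduct_sub, Matrix.mulVec_single_one, single_one_dotProduct,
    Matrix.col_apply, hsymm] at hadd hsub
  rw [abs_le]
  constructor <;> linarith

theorem isClosed_setOf_posSemidef : IsClosed {S : Matrix n n ℝ | S.PosSemidef} := by
  have := Fintype.ofFinite n
  have hset : {S : Matrix n n ℝ | S.PosSemidef} = {S | S.conjTranspose = S} ∩
      ⋂ x : n → ℝ, {S | 0 ≤ star x ⬝ᵥ S.mulVec x} := by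
    ext S
    simpa only [Set.mem_inter_iff, Set.mem_iInter] using!
      Matrix.posSemidef_iff_dotProduct_mulVec
  rw [hset]
  refine (isClosed_eq (by fun_prop) continuous_id).inter (isClosed_iInter fun x => ?_)
  exact isClosed_le continuous_const
    (continuous_const.dotProduct (continuous_id.matrix_mulVec continuous_const))

theorem isCompact_setOf_posSemidef_diag_eq (D : n → ℝ) :
    IsCompact {S : Matrix n n ℝ | S.PosSemidef ∧ S.diag = D} := by
  have hbox : IsCompact (Set.univ.pi fun i : n => Set.univ.pi fun j : n =>
      Set.Icc (-((D i + D j) / 2)) ((D i + D j) / 2)) :=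
    isCompact_univ_pi fun _ => isCompact_univ_pi fun _ => isCompact_Icc
  refine hbox.of_isClosed_subset (isClosed_setOf_posSemidef.inter
    (isClosed_eq continuous_id.matrix_diag continuous_const)) ?_
  rintro S ⟨hS, rfl⟩ i - j -
  exact abs_le.mp (abs_apply_le_of_posSemidef hS i j)

end PosSemidef

section Couplings

variable {J d : ℕ} {lam : Fin J → ℝ} {μ : Fin J → Measure (Rd d)} {γ : Measure (Fin J → Rd d)}

theorem aemeasurable_eval (j : Fin J) (γ : Measure (Fin J → Rd d)) :
    AEMeasurable (fun x : Fin J → Rd d => x j) γ :=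
  (measurable_pi_apply j).aemeasurable

theorem aestronglyMeasurable_coord (u : Fin J × Fin d) (γ : Measure (Fin J → Rd d)) :
    AEStronglyMeasurable (fun x : Fin J → Rd d => x u.1 u.2) γ :=
  Continuous.aestronglyMeasurable (by fun_prop)

theorem cost_nonneg (hlam : ∀ j, 0 ≤ lam j) (x : Fin J → Rd d) : 0 ≤ cost lam x :=
  mul_nonneg (by norm_num) (Finset.sum_nonneg fun i _ => Finset.sum_nonneg fun j _ =>
    mul_nonneg (mul_nonneg (hlam i) (hlam j)) (sq_nonneg _))

theorem cost_eq_sum_coord (lam : Fin J → ℝ) (x : Fin J → Rd d) :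
    cost lam x = (1 / 2) * ∑ i, ∑ j, lam i * lam j * ∑ a, (x i a - x j a) ^ 2 := by
  simp [cost, EuclideanSpace.norm_sq_eq]

/-- The expected cost of a plan whose coordinates have mean vector `m` and covariance
matrix `S`. -/
noncomputable def momentCost (lam : Fin J → ℝ) (m : Fin J × Fin d → ℝ)
    (S : Matrix (Fin J × Fin d) (Fin J × Fin d) ℝ) : ℝ :=
  (1 / 2) * ∑ i, ∑ j, lam i * lam j * ∑ a, ((m (i, a) - m (j, a)) ^ 2 +
    (S (i, a) (i, a) - 2 * S (i, a) (j, a) + S (j, a) (j, a)))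

/-- The covariance matrix of the coordinates of a plan on `(ℝ^d)^J`. -/
noncomputable def coordCov (γ : Measure (Fin J → Rd d)) :
    Matrix (Fin J × Fin d) (Fin J × Fin d) ℝ :=
  covarianceMatrix (fun u x => x u.1 u.2) γ

section

variable (hγ : ∀ j a, MemLp (fun x : Fin J → Rd d => x j a) 2 γ)
include hγ

theorem integrable_sum_sub_sq (i j : Fin J) :
    Integrable (fun x : Fin J → Rd d => ∑ a, (x i a - x j a) ^ 2) γ :=
  integrable_finsetSum _ fun a _ => ((hγ i a).sub (hγ j a)).integrable_sq

theorem integrable_cost (lam : Fin J → ℝ) : Integrable (cost lam) γ := by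
  simp only [funext (cost_eq_sum_coord lam)]
  exact (integrable_finsetSum _ fun i _ => integrable_finsetSum _ fun j _ =>
    (integrable_sum_sub_sq hγ i j).const_mul _).const_mul _

theorem integral_cost [IsProbabilityMeasure γ] (lam : Fin J → ℝ) :
    ∫ x, cost lam x ∂γ = momentCost lam (fun u => ∫ x, x u.1 u.2 ∂γ) (coordCov γ) := by
  have hint (i j : Fin J) := (integrable_sum_sub_sq hγ i j).const_mul (lam i * lam j)
  simp only [cost_eq_sum_coord]
  rw [integral_const_mul,
    integral_finsetSum _ fun i _ => integrable_finsetSum _ fun j _ => hint i j]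
  refine congrArg _ (Finset.sum_congr rfl fun i _ => ?_)
  rw [integral_finsetSum _ fun j _ => hint i j]
  refine Finset.sum_congr rfl fun j _ => ?_
  rw [integral_const_mul]
  refine congrArg _ ((integral_finsetSum _ fun a _ =>
    ((hγ i a).sub (hγ j a)).integrable_sq).trans ?_)
  exact Finset.sum_congr rfl fun a _ => integral_sub_sq_eq (hγ i a) (hγ j a)

end

theorem memLp_coord_of_mem_couplings (hμ : ∀ j, MemLp id 2 (μ j)) (hγ : γ ∈ couplings μ)
    (j : Fin J) (a : Fin d) : MemLp (fun x : Fin J → Rd d => x j a) 2 γ := by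
  have hj := (hμ j).eval_piLp a
  rw [← hγ.2 j] at hj
  exact (memLp_map_measure_iff (by fun_prop) (aemeasurable_eval j γ)).mp hj

/-- The mean vector of the coordinates of any coupling of `μ`. -/
noncomputable def marginalMean (μ : Fin J → Measure (Rd d)) (u : Fin J × Fin d) : ℝ :=
  ∫ y : Rd d, y u.2 ∂(μ u.1)

theorem integral_coord_of_mem_couplings (hγ : γ ∈ couplings μ) (u : Fin J × Fin d) :
    ∫ x, x u.1 u.2 ∂γ = marginalMean μ u := by
  rw [marginalMean, ← hγ.2 u.1, integral_map (aemeasurable_eval u.1 γ) (by fun_prop)]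

theorem planCost_eq_momentCost (hlam : ∀ j, 0 ≤ lam j) (hμ : ∀ j, MemLp id 2 (μ j))
    (hγ : γ ∈ couplings μ) :
    planCost lam γ = ENNReal.ofReal (momentCost lam (marginalMean μ) (coordCov γ)) := by
  have : IsProbabilityMeasure γ := hγ.1
  have hmem := memLp_coord_of_mem_couplings hμ hγ
  rw [planCost, ← ofReal_integral_eq_lintegral_ofReal (integrable_cost hmem lam)
    (.of_forall (cost_nonneg hlam)), integral_cost hmem,
    funext (integral_coord_of_mem_couplings hγ)]

/-- The covariance matrices compatible with the marginals `μ`: positive semidefinite matrices whose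
diagonal blocks are the covariance matrices of the `μ j`. -/
def covSet (μ : Fin J → Measure (Rd d)) : Set (Matrix (Fin J × Fin d) (Fin J × Fin d) ℝ) :=
  {S | S.PosSemidef ∧ ∀ j a b, S (j, a) (j, b) = cov[fun y => y a, fun y => y b; μ j]}

theorem coordCov_mem_covSet (hμ : ∀ j, MemLp id 2 (μ j)) (hγ : γ ∈ couplings μ) :
    coordCov γ ∈ covSet μ := by
  have : IsProbabilityMeasure γ := hγ.1
  refine ⟨posSemidef_covarianceMatrix fun u => memLp_coord_of_mem_couplings hμ hγ u.1 u.2,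
    fun j a b => ?_⟩
  rw [← hγ.2 j, covariance_map_fun (by fun_prop) (by fun_prop) (aemeasurable_eval j γ)]
  rfl

theorem isCompact_covSet (μ : Fin J → Measure (Rd d)) : IsCompact (covSet μ) := by
  let D (u : Fin J × Fin d) : ℝ := cov[fun y => y u.2, fun y => y u.2; μ u.1]
  have hset : covSet μ = {S | S.PosSemidef ∧ S.diag = D} ∩
      ⋂ j, ⋂ a, ⋂ b, {S | S (j, a) (j, b) = cov[fun y => y a, fun y => y b; μ j]} := by
    ext S
    simp only [covSet, Set.mem_inter_iff, Set.mem_iInter, Set.mem_ofPred_eq]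
    exact ⟨fun h => ⟨⟨h.1, funext fun u => h.2 u.1 u.2 u.2⟩, h.2⟩, fun h => ⟨h.1.1, h.2⟩⟩
  rw [hset]
  exact (isCompact_setOf_posSemidef_diag_eq D).inter_right <| isClosed_iInter fun j =>
    isClosed_iInter fun a => isClosed_iInter fun b =>
      isClosed_eq (continuous_id.matrix_elem _ _) continuous_const

theorem pi_mem_couplings (μ : Fin J → Measure (Rd d)) [∀ j, IsProbabilityMeasure (μ j)] :
    Measure.pi μ ∈ couplings μ :=
  ⟨inferInstance, fun j => (measurePreserving_eval μ j).map_eq⟩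

theorem mmW2sq_lt_top (hlam : ∀ j, 0 ≤ lam j) [∀ j, IsProbabilityMeasure (μ j)]
    (hμ : ∀ j, MemLp id 2 (μ j)) : mmW2sq lam μ < ⊤ :=
  calc mmW2sq lam μ ≤ planCost lam (Measure.pi μ) := iInf₂_le _ (pi_mem_couplings μ)
    _ = ENNReal.ofReal _ := planCost_eq_momentCost hlam hμ (pi_mem_couplings μ)
    _ < ⊤ := ENNReal.ofReal_lt_top

/-- The linear map grouping the coordinates of `ℝ^(J × d)` into `J` vectors of `ℝ^d`. -/
noncomputable def groupCoords (J d : ℕ) : EuclideanSpace ℝ (Fin J × Fin d) →L[ℝ] (Fin J → Rd d) :=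
  LinearMap.toContinuousLinearMap
    { toFun := fun x j => WithLp.toLp 2 fun a => x (j, a)
      map_add' := fun _ _ => rfl
      map_smul' := fun _ _ => rfl }

/-- The Gaussian measure on `(ℝ^d)^J` whose coordinates have mean vector `m` and, when `S` is
positive semidefinite, covariance matrix `S`. -/
noncomputable def gaussianPlan (m : Fin J × Fin d → ℝ)
    (S : Matrix (Fin J × Fin d) (Fin J × Fin d) ℝ) : Measure (Fin J → Rd d) :=
  (multivariateGaussian (WithLp.toLp 2 m) S).map (groupCoords J d)

section GaussianPlan

variable (m : Fin J × Fin d → ℝ) {S : Matrix (Fin J × Fin d) (Fin J × Fin d) ℝ}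

instance isGaussian_gaussianPlan : IsGaussian (gaussianPlan m S) := by
  unfold gaussianPlan
  infer_instance

theorem integral_coord_gaussianPlan (u : Fin J × Fin d) :
    ∫ x, x u.1 u.2 ∂(gaussianPlan m S) = m u := by
  rw [gaussianPlan, integral_map (by fun_prop) (aestronglyMeasurable_coord u _)]
  refine (integral_apply_of_memLp IsGaussian.memLp_two_id u).symm.trans ?_
  rw [integral_id_multivariateGaussian]

theorem coordCov_gaussianPlan (hS : S.PosSemidef) : coordCov (gaussianPlan m S) = S := by
  ext u v
  rw [coordCov, covarianceMatrix, Matrix.of_apply, gaussianPlan,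
    covariance_map_fun (aestronglyMeasurable_coord u _) (aestronglyMeasurable_coord v _)
      (by fun_prop)]
  exact covariance_eval_multivariateGaussian hS u v

end GaussianPlan

theorem gaussianPlan_mem_couplings (hμ : ∀ j, IsGaussian (μ j))
    {S : Matrix (Fin J × Fin d) (Fin J × Fin d) ℝ} (hS : S ∈ covSet μ) :
    gaussianPlan (marginalMean μ) S ∈ couplings μ := by
  refine ⟨inferInstance, fun j => ?_⟩
  have : IsGaussian ((gaussianPlan (marginalMean μ) S).map fun x => x j) :=
    isGaussian_map (ContinuousLinearMap.proj (R := ℝ) (φ := fun _ : Fin J => Rd d) j)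
  refine eq_of_isGaussian_of_moments_eq (fun a => ?_) fun a b => ?_
  · rw [integral_map (aemeasurable_eval j _) (by fun_prop)]
    exact integral_coord_gaussianPlan (marginalMean μ) (j, a)
  · rw [covariance_map_fun (by fun_prop) (by fun_prop) (aemeasurable_eval j _), ← hS.2 j a b]
    exact congrFun₂ (coordCov_gaussianPlan (marginalMean μ) hS.1) (j, a) (j, b)

theorem exists_isGaussian_isOptimalPlan (hlam : ∀ j, 0 ≤ lam j) (hμ : ∀ j, IsGaussian (μ j)) :
    ∃ γ : Measure (Fin J → Rd d), IsGaussian γ ∧ IsOptimalPlan lam μ γ := by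
  have hmem : ∀ j, MemLp id 2 (μ j) := fun j => IsGaussian.memLp_two_id
  have hcont : Continuous (momentCost lam (marginalMean μ)) := by
    unfold momentCost
    fun_prop
  obtain ⟨S, hS, hmin⟩ := (isCompact_covSet μ).exists_isMinOn
    ⟨_, coordCov_mem_covSet hmem (pi_mem_couplings μ)⟩ hcont.continuousOn
  have hplan := gaussianPlan_mem_couplings hμ hS
  refine ⟨_, inferInstance, hplan, le_antisymm (le_iInf₂ fun γ hγ => ?_) (iInf₂_le _ hplan)⟩
  rw [planCost_eq_momentCost hlam hmem hγ, planCost_eq_momentCost hlam hmem hplan,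
    coordCov_gaussianPlan _ hS.1]
  exact ENNReal.ofReal_le_ofReal (hmin (coordCov_mem_covSet hmem hγ))

end Couplings

/-! ### Mixtures -/

section Mixture

variable {ι ι' E F : Type*} [Fintype ι] [Fintype ι'] [MeasurableSpace E] [MeasurableSpace F]

theorem map_mixture (w : ι → ℝ≥0) (γ : ι → Measure E) {f : E → F} (hf : Measurable f) :
    (mixture w γ).map f = mixture w fun k => (γ k).map f := by
  simp [mixture, Measure.map_finset_sum hf.aemeasurable]

theorem mixture_congr {w : ι → ℝ≥0} {γ γ' : ι → Measure E} (h : ∀ k, w k ≠ 0 → γ k = γ' k) :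
    mixture w γ = mixture w γ' := by
  refine Finset.sum_congr rfl fun k _ => ?_
  by_cases hk : w k = 0
  · simp [hk]
  · rw [h k hk]

theorem mixture_const (w : ι → ℝ≥0) (μ : Measure E) :
    mixture w (fun _ => μ) = (∑ k, w k) • μ :=
  Finset.sum_smul.symm

theorem mixture_comp (f : ι → ι') (w : ι → ℝ≥0) (μ : ι' → Measure E) :
    mixture w (fun i => μ (f i)) = mixture (fiberWeight f w) μ := by
  classical
  simp only [mixture, fiberWeight, Finset.sum_smul]
  rw [← Finset.sum_fiberwise Finset.univ f fun i => w i • μ (f i)]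
  refine Finset.sum_congr rfl fun k _ => ?_
  convert Finset.sum_congr rfl fun i hi => ?_
  rw [(Finset.mem_filter.mp hi).2]

theorem mixture_sum_eq_mixture_mixture (v : ι → ι' → ℝ≥0) (ν : ι → Measure E) :
    mixture (fun l => ∑ k, v l k) ν =
      mixture (fun k => ∑ l, v l k) fun k => mixture (fun l => v l k / ∑ l', v l' k) ν := by
  simp only [mixture, Finset.smul_sum, Finset.sum_smul, smul_smul]
  rw [Finset.sum_comm]
  refine Finset.sum_congr rfl fun k _ => Finset.sum_congr rfl fun l _ => ?_
  rw [mul_div_cancel_of_imp']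
  exact fun h => Finset.sum_eq_zero_iff.mp h l (Finset.mem_univ l)

theorem isProbabilityMeasure_mixture {w : ι → ℝ≥0} (hw : ∑ k, w k = 1) {γ : ι → Measure E}
    (hγ : ∀ k, IsProbabilityMeasure (γ k)) : IsProbabilityMeasure (mixture w γ) := by
  refine ⟨?_⟩
  simp only [mixture, Measure.finsetSum_apply, Measure.smul_apply, measure_univ]
  rw [← Finset.sum_smul, hw, one_smul]

theorem isGMM_mixture [TopologicalSpace E] [AddCommMonoid E] [Module ℝ E] {w : ι → ℝ≥0}
    (hw : ∑ k, w k = 1) {γ : ι → Measure E} (hγ : ∀ k, IsGaussian (γ k)) :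
    IsGMM (mixture w γ) := by
  let e := (Fintype.equivFin ι).symm
  exact ⟨Fintype.card ι, w ∘ e, γ ∘ e, (e.sum_comp w).trans hw, fun k => hγ (e k),
    (e.sum_comp fun k => w k • γ k).symm⟩

theorem IsGMM.of_isGaussian [TopologicalSpace E] [AddCommMonoid E] [Module ℝ E] {γ : Measure E}
    (hγ : IsGaussian γ) : IsGMM γ :=
  ⟨1, 1, fun _ => γ, by simp, fun _ => hγ, by simp [mixture]⟩

theorem planCost_mixture {J d : ℕ} (lam : Fin J → ℝ) (w : ι → ℝ≥0)
    (γ : ι → Measure (Fin J → Rd d)) :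
    planCost lam (mixture w γ) = ∑ k, (w k : ℝ≥0∞) * planCost lam (γ k) := by
  simp only [planCost, mixture, lintegral_finsetSum_measure, lintegral_smul_measure,
    ENNReal.smul_def, smul_eq_mul]

end Mixture

/-! ### Tensors with prescribed marginals -/

theorem sum_filter_prod_eq {ι R : Type*} [Fintype ι] [DecidableEq ι] [CommSemiring R]
    {α : ι → Type*} [∀ i, Fintype (α i)]
    [∀ i, DecidableEq (α i)] {r : ∀ i, α i → R} {j : ι}
    (hr : ∀ i ≠ j, ∑ k, r i k = 1) (k : α j) :
    ∑ κ : ∀ i, α i with κ j = k, ∏ i, r i (κ i) = r j k := by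
  rw [← Fintype.piFinset_univ, ← Fintype.piFinset_update_singleton_eq_filter_piFinset_eq
    (fun i => (Finset.univ : Finset (α i))) j (Finset.mem_univ k), ← Finset.prod_univ_sum,
    Fintype.prod_eq_single j fun i hi => by simp [hi, hr]]
  simp

section CondWeight

variable {ι ι' X : Type*} [Fintype ι] [Fintype ι'] {f : ι → X} {p : ι → ℝ≥0}

open Classical in
/-- The conditional weights `pₖ / ∑ p` on the fiber `fₖ = x`, zero off the fiber. They are all zero
when the fiber has no mass. -/
noncomputable def condWeight (f : ι → X) (p : ι → ℝ≥0) (x : X) (k : ι) : ℝ≥0 :=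
  if f k = x then p k / fiberWeight f p x else 0

theorem le_fiberWeight (f : ι → X) (p : ι → ℝ≥0) (k : ι) : p k ≤ fiberWeight f p (f k) := by
  classical
  exact Finset.single_le_sum (fun _ _ => zero_le) (by simp)

theorem sum_condWeight {x : X} (hx : fiberWeight f p x ≠ 0) : ∑ k, condWeight f p x k = 1 := by
  simp only [condWeight, ← Finset.sum_filter, ← Finset.sum_div]
  exact div_self hx

theorem sum_mul_condWeight {g : ι' → X} {q : ι' → ℝ≥0}
    (h : fiberWeight f p = fiberWeight g q) (k : ι) :
    ∑ l, q l * condWeight f p (g l) k = p k := by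
  classical
  calc ∑ l, q l * condWeight f p (g l) k
      = ∑ l with g l = f k, q l * (p k / fiberWeight f p (f k)) := by
        rw [Finset.sum_filter]
        refine Finset.sum_congr rfl fun l _ => ?_
        by_cases hl : g l = f k
        · simp [condWeight, hl]
        · simp [condWeight, hl, Ne.symm hl]
    _ = fiberWeight f p (f k) * (p k / fiberWeight f p (f k)) := by
        rw [← Finset.sum_mul, h, fiberWeight]
    _ = p k := mul_div_cancel_of_imp' fun h0 => le_zero_iff.mp (h0 ▸ le_fiberWeight f p k)

end CondWeight

section Tensor

variable {J : ℕ} {K : Fin J → ℕ} {p : ∀ j, Fin (K j) → ℝ≥0} {w : (∀ j, Fin (K j)) → ℝ≥0}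

theorem sum_eq_of_mem_tensorCouplings (hw : w ∈ tensorCouplings p) (j : Fin J) :
    ∑ κ, w κ = ∑ k, p j k := by
  rw [← Finset.sum_fiberwise Finset.univ (fun κ : ∀ j, Fin (K j) => κ j) w]
  exact Finset.sum_congr rfl fun k _ => hw j k

theorem fiberWeight_eval_of_mem_tensorCouplings (hw : w ∈ tensorCouplings p) (j : Fin J) :
    fiberWeight (fun κ : ∀ j, Fin (K j) => κ j) w = p j := by
  ext k
  rw [← hw j k, fiberWeight]
  congr!

theorem nonempty_tensorCouplings (hp : ∀ j, ∑ k, p j k = 1) : (tensorCouplings p).Nonempty :=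
  ⟨fun κ => ∏ i, p i (κ i), fun _ k => sum_filter_prod_eq (fun i _ => hp i) k⟩

theorem isCompact_tensorCouplings [NeZero J] (p : ∀ j, Fin (K j) → ℝ≥0) :
    IsCompact (tensorCouplings p) := by
  have hclosed : IsClosed (tensorCouplings p) := by
    simp only [tensorCouplings, Set.ofPred_forall]
    exact isClosed_iInter fun j => isClosed_iInter fun k =>
      isClosed_eq (continuous_finsetSum _ fun κ _ => continuous_apply κ) continuous_const
  refine (isCompact_univ_pi fun κ : ∀ j, Fin (K j) =>
    isCompact_Icc (a := 0) (b := p 0 (κ 0))).of_isClosed_subset hclosed fun w hw κ _ =>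
      ⟨zero_le, ?_⟩
  rw [← hw 0 (κ 0)]
  exact Finset.single_le_sum (fun _ _ => zero_le) (by simp)

theorem exists_gluing {ι X : Type*} [Fintype ι] {f : ∀ j, Fin (K j) → X} {g : Fin J → ι → X}
    {q : ι → ℝ≥0} (h : ∀ j, fiberWeight (f j) (p j) = fiberWeight (g j) q) :
    ∃ v : ι → (∀ j, Fin (K j)) → ℝ≥0, (∀ l, ∑ κ, v l κ = q l) ∧
      (∀ l κ, v l κ ≠ 0 → ∀ j, f j (κ j) = g j l) ∧
      (fun κ => ∑ l, v l κ) ∈ tensorCouplings p := by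
  have hsum (l : ι) (hl : q l ≠ 0) (j : Fin J) :
      ∑ k, condWeight (f j) (p j) (g j l) k = 1 :=
    sum_condWeight fun h0 => hl (le_zero_iff.mp (h0 ▸ h j ▸ le_fiberWeight (g j) q l))
  refine ⟨fun l κ => q l * ∏ j, condWeight (f j) (p j) (g j l) (κ j), fun l => ?_,
    fun l κ hv j => ?_, fun j k => ?_⟩
  · rw [← Finset.mul_sum, ← Fintype.prod_sum]
    by_cases hl : q l = 0
    · simp [hl]
    · simp [hsum l hl]
  · by_contra hne
    exact hv (mul_eq_zero_of_right _
      (Finset.prod_eq_zero (Finset.mem_univ j) (by simp [condWeight, hne])))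
  · rw [Finset.sum_comm, ← sum_mul_condWeight (h j) k]
    refine Finset.sum_congr rfl fun l _ => ?_
    rw [← Finset.mul_sum]
    by_cases hl : q l = 0
    · simp [hl]
    · rw [sum_filter_prod_eq (fun i _ => hsum l hl i)]

end Tensor

theorem mmW2sq_ne_top_of_isGaussian {J d : ℕ} {lam : Fin J → ℝ} (hlam : ∀ j, 0 ≤ lam j)
    {μ : Fin J → Measure (Rd d)} (hμ : ∀ j, IsGaussian (μ j)) : mmW2sq lam μ ≠ ⊤ :=
  have := fun j => (hμ j).toIsProbabilityMeasure
  (mmW2sq_lt_top hlam fun _ => IsGaussian.memLp_two_id).ne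

/-! ### Reduction to the discrete linear program -/

section Program

variable {J d : ℕ} {K : Fin J → ℕ} {lam : Fin J → ℝ} {p : ∀ j, Fin (K j) → ℝ≥0}
  {comp : ∀ j, Fin (K j) → Measure (Rd d)} {w : (∀ j, Fin (K j)) → ℝ≥0}
  {γ : (∀ j, Fin (K j)) → Measure (Fin J → Rd d)}

theorem mixture_mem_couplings {ι : Type*} [Fintype ι] {w : ι → ℝ≥0} (hw : ∑ i, w i = 1)
    {γ : ι → Measure (Fin J → Rd d)} {μ : ι → Fin J → Measure (Rd d)}
    (hγ : ∀ i, γ i ∈ couplings (μ i)) :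
    mixture w γ ∈ couplings fun j => mixture w fun i => μ i j := by
  refine ⟨isProbabilityMeasure_mixture hw fun i => (hγ i).1, fun j => ?_⟩
  rw [map_mixture w γ (measurable_pi_apply j)]
  simp only [fun i => (hγ i).2 j]

theorem mixture_mem_couplings_of_mem_tensorCouplings [NeZero J] (hp : ∀ j, ∑ k, p j k = 1)
    (hw : w ∈ tensorCouplings p) (hγ : ∀ κ, γ κ ∈ couplings fun j => comp j (κ j)) :
    mixture w γ ∈ couplings fun j => mixture (p j) (comp j) := by
  have h := mixture_mem_couplings ((sum_eq_of_mem_tensorCouplings hw 0).trans (hp 0)) hγ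
  simpa only [mixture_comp, fiberWeight_eval_of_mem_tensorCouplings hw] using h

theorem exists_eq_mixture_of_mem_couplings (hcomp : ∀ j k, IsGaussian (comp j k))
    {γ : Measure (Fin J → Rd d)} (hγ : γ ∈ couplings fun j => mixture (p j) (comp j))
    (hG : IsGMM γ) :
    ∃ w ∈ tensorCouplings p, ∃ γ' : (∀ j, Fin (K j)) → Measure (Fin J → Rd d),
      (∀ κ, w κ ≠ 0 → IsGMM (γ' κ) ∧ γ' κ ∈ couplings fun j => comp j (κ j)) ∧
      γ = mixture w γ' := by
  obtain ⟨N, q, ν, -, hν, rfl⟩ := hG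
  have hmarginal (j : Fin J) (l : Fin N) : IsGaussian ((ν l).map fun x => x j) :=
    have := hν l
    isGaussian_map (ContinuousLinearMap.proj (R := ℝ) (φ := fun _ : Fin J => Rd d) j)
  have hweight (j : Fin J) :
      fiberWeight (comp j) (p j) = fiberWeight (fun l => (ν l).map fun x => x j) q := by
    refine fiberWeight_eq_of_mixture_eq linearIndepOn_isGaussian (hcomp j) (hmarginal j) ?_
    rw [← map_mixture q ν (measurable_pi_apply j)]
    exact (hγ.2 j).symm
  obtain ⟨v, hvq, hvν, hvp⟩ := exists_gluing hweight
  refine ⟨_, hvp, fun κ => mixture (fun l => v l κ / ∑ l', v l' κ) ν, fun κ hκ => ?_, ?_⟩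
  · have hone : ∑ l, v l κ / ∑ l', v l' κ = 1 := by
      rw [← Finset.sum_div]
      exact div_self hκ
    refine ⟨isGMM_mixture hone hν,
      isProbabilityMeasure_mixture hone fun l => (hν l).toIsProbabilityMeasure, fun j => ?_⟩
    rw [map_mixture _ ν (measurable_pi_apply j),
      mixture_congr (γ' := fun _ => comp j (κ j)), mixture_const, hone, one_smul]
    exact fun l hl => (hvν l κ (fun h0 => hl (by simp [h0])) j).symm
  · rw [← mixture_sum_eq_mixture_mixture, funext hvq]

theorem discreteCost_ne_top (hfin : ∀ κ : ∀ j, Fin (K j), mmW2sq lam (fun j => comp j (κ j)) ≠ ⊤)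
    (w : (∀ j, Fin (K j)) → ℝ≥0) : discreteCost lam comp w ≠ ⊤ :=
  ENNReal.sum_ne_top.mpr fun κ _ => ENNReal.mul_ne_top ENNReal.coe_ne_top (hfin κ)

theorem exists_isOptimalTensor [NeZero J] (hp : ∀ j, ∑ k, p j k = 1)
    (hfin : ∀ κ : ∀ j, Fin (K j), mmW2sq lam (fun j => comp j (κ j)) ≠ ⊤) :
    ∃ w, IsOptimalTensor lam p comp w := by
  have hcont : Continuous (discreteCost lam comp) :=
    continuous_finsetSum _ fun κ _ => (ENNReal.continuous_mul_const (hfin κ)).comp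
      (ENNReal.continuous_coe.comp (continuous_apply κ))
  obtain ⟨w, hw, hmin⟩ := (isCompact_tensorCouplings p).exists_isMinOn
    (nonempty_tensorCouplings hp) hcont.continuousOn
  exact ⟨w, hw, fun w' hw' => hmin hw'⟩

theorem planCost_mixture_eq_discreteCost
    (hγ : ∀ κ, IsOptimalPlan lam (fun j => comp j (κ j)) (γ κ)) (w : (∀ j, Fin (K j)) → ℝ≥0) :
    planCost lam (mixture w γ) = discreteCost lam comp w := by
  simp only [planCost_mixture, discreteCost, fun κ => (hγ κ).2]

theorem mul_mmW2sq_le_mul_planCost (hγ : ∀ κ, w κ ≠ 0 → γ κ ∈ couplings fun j => comp j (κ j))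
    (κ : ∀ j, Fin (K j)) :
    (w κ : ℝ≥0∞) * mmW2sq lam (fun j => comp j (κ j)) ≤ w κ * planCost lam (γ κ) := by
  by_cases hκ : w κ = 0
  · simp [hκ]
  · gcongr
    exact iInf₂_le _ (hγ κ hκ)

theorem discreteCost_le_planCost_mixture
    (hγ : ∀ κ, w κ ≠ 0 → γ κ ∈ couplings fun j => comp j (κ j)) :
    discreteCost lam comp w ≤ planCost lam (mixture w γ) := by
  rw [planCost_mixture]
  exact Finset.sum_le_sum fun κ _ => mul_mmW2sq_le_mul_planCost hγ κ

theorem isOptimalPlan_of_planCost_mixture_le (hfin : discreteCost lam comp w ≠ ⊤)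
    (hγ : ∀ κ, w κ ≠ 0 → γ κ ∈ couplings fun j => comp j (κ j))
    (hle : planCost lam (mixture w γ) ≤ discreteCost lam comp w) {κ : ∀ j, Fin (K j)}
    (hκ : w κ ≠ 0) : IsOptimalPlan lam (fun j => comp j (κ j)) (γ κ) := by
  refine ⟨hγ κ hκ, le_antisymm (not_lt.mp fun hlt => hle.not_gt ?_) (iInf₂_le _ (hγ κ hκ))⟩
  rw [planCost_mixture]
  simp only [discreteCost, ← tsum_fintype (L := .unconditional _)] at hfin ⊢
  exact ENNReal.tsum_lt_tsum hfin (mul_mmW2sq_le_mul_planCost hγ)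
    (ENNReal.mul_lt_mul_right (by exact_mod_cast hκ) ENNReal.coe_ne_top hlt)

theorem MMW2sq_le_discreteCost [NeZero J] (hlam : ∀ j, 0 ≤ lam j) (hp : ∀ j, ∑ k, p j k = 1)
    (hcomp : ∀ j k, IsGaussian (comp j k)) (hw : w ∈ tensorCouplings p) :
    MMW2sq lam (fun j => mixture (p j) (comp j)) ≤ discreteCost lam comp w := by
  choose γ hγG hγ using fun κ : ∀ j, Fin (K j) =>
    exists_isGaussian_isOptimalPlan hlam fun j => hcomp j (κ j)
  rw [← planCost_mixture_eq_discreteCost hγ w]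
  exact iInf₂_le _ ⟨mixture_mem_couplings_of_mem_tensorCouplings hp hw fun κ => (hγ κ).1,
    isGMM_mixture ((sum_eq_of_mem_tensorCouplings hw 0).trans (hp 0)) hγG⟩

theorem MMW2sq_eq_discreteCost [NeZero J] (hlam : ∀ j, 0 ≤ lam j) (hp : ∀ j, ∑ k, p j k = 1)
    (hcomp : ∀ j k, IsGaussian (comp j k)) (hw : IsOptimalTensor lam p comp w) :
    MMW2sq lam (fun j => mixture (p j) (comp j)) = discreteCost lam comp w := by
  refine le_antisymm (MMW2sq_le_discreteCost hlam hp hcomp hw.1) (le_iInf₂ fun γ hγ => ?_)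
  obtain ⟨w', hw', γ', hγ', rfl⟩ := exists_eq_mixture_of_mem_couplings hcomp hγ.1 hγ.2
  exact (hw.2 w' hw').trans (discreteCost_le_planCost_mixture fun κ hκ => (hγ' κ hκ).2)

theorem isOptimalGMMPlan_mixture [NeZero J] (hlam : ∀ j, 0 ≤ lam j) (hp : ∀ j, ∑ k, p j k = 1)
    (hcomp : ∀ j k, IsGaussian (comp j k)) (hw : IsOptimalTensor lam p comp w)
    (hγ : ∀ κ, IsGaussian (γ κ) ∧ IsOptimalPlan lam (fun j => comp j (κ j)) (γ κ)) :
    IsOptimalGMMPlan lam (fun j => mixture (p j) (comp j)) (mixture w γ) :=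
  ⟨mixture_mem_couplings_of_mem_tensorCouplings hp hw.1 fun κ => (hγ κ).2.1,
    isGMM_mixture ((sum_eq_of_mem_tensorCouplings hw.1 0).trans (hp 0)) fun κ => (hγ κ).1,
    (planCost_mixture_eq_discreteCost (fun κ => (hγ κ).2) w).trans
      (MMW2sq_eq_discreteCost hlam hp hcomp hw).symm⟩

theorem exists_isOptimalTensor_of_isOptimalGMMPlan [NeZero J] (hlam : ∀ j, 0 ≤ lam j)
    (hp : ∀ j, ∑ k, p j k = 1) (hcomp : ∀ j k, IsGaussian (comp j k))
    {γs : Measure (Fin J → Rd d)}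
    (hγs : IsOptimalGMMPlan lam (fun j => mixture (p j) (comp j)) γs) :
    ∃ (w : (∀ j, Fin (K j)) → ℝ≥0) (γ : (∀ j, Fin (K j)) → Measure (Fin J → Rd d)),
      IsOptimalTensor lam p comp w ∧
      (∀ κ, IsGMM (γ κ) ∧ IsOptimalPlan lam (fun j => comp j (κ j)) (γ κ)) ∧
      γs = mixture w γ := by
  obtain ⟨hγsc, hγsG, hγscost⟩ := hγs
  obtain ⟨w, hw, γ, hγ, rfl⟩ := exists_eq_mixture_of_mem_couplings hcomp hγsc hγsG
  have hfin : discreteCost lam comp w ≠ ⊤ :=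
    discreteCost_ne_top (fun κ => mmW2sq_ne_top_of_isGaussian hlam fun j => hcomp j (κ j)) w
  have hle : planCost lam (mixture w γ) ≤ discreteCost lam comp w :=
    hγscost.trans_le (MMW2sq_le_discreteCost hlam hp hcomp hw)
  have hopt : IsOptimalTensor lam p comp w := ⟨hw, fun w' hw' =>
    (discreteCost_le_planCost_mixture fun κ hκ => (hγ κ hκ).2).trans <| hγscost.trans_le <|
      MMW2sq_le_discreteCost hlam hp hcomp hw'⟩
  have hplan (κ : ∀ j, Fin (K j)) : ∃ γκ, (IsGMM γκ ∧
      IsOptimalPlan lam (fun j => comp j (κ j)) γκ) ∧ (w κ ≠ 0 → γ κ = γκ) := by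
    by_cases hκ : w κ = 0
    · obtain ⟨γκ, hG, hγκ⟩ := exists_isGaussian_isOptimalPlan hlam fun j => hcomp j (κ j)
      exact ⟨γκ, ⟨.of_isGaussian hG, hγκ⟩, fun h => absurd hκ h⟩
    · exact ⟨γ κ, ⟨(hγ κ hκ).1, isOptimalPlan_of_planCost_mixture_le hfin
        (fun κ hκ => (hγ κ hκ).2) hle hκ⟩, fun _ => rfl⟩
  choose γ' hγ' hγγ' using hplan
  exact ⟨w, γ', hopt, hγ', mixture_congr hγγ'⟩

end Program

end GMMOT

open GMMOT in
theorem mainTheorem4_general {J d : ℕ} [NeZero J]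
    (lam : Fin J → ℝ) (hlam : ∀ j, 0 ≤ lam j)
    (K : Fin J → ℕ)
    (p : ∀ j, Fin (K j) → ℝ≥0) (hp : ∀ j, ∑ k, p j k = 1)
    (comp : ∀ j, Fin (K j) → Measure (Rd d)) (hcomp : ∀ j k, IsGaussian (comp j k))
    (μ : Fin J → Measure (Rd d)) (hμ : ∀ j, μ j = mixture (p j) (comp j)) :
    MMW2sq lam μ < ⊤ ∧
    IsLeast (discreteCost lam comp '' tensorCouplings p) (MMW2sq lam μ) ∧
    (∀ κ : ∀ j, Fin (K j), ∃ γ : Measure (Fin J → Rd d),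
      IsGaussian γ ∧ IsOptimalPlan lam (fun j => comp j (κ j)) γ) ∧
    (∀ (w : (∀ j, Fin (K j)) → ℝ≥0) (γ : (∀ j, Fin (K j)) → Measure (Fin J → Rd d)),
      IsOptimalTensor lam p comp w →
      (∀ κ, IsGaussian (γ κ) ∧ IsOptimalPlan lam (fun j => comp j (κ j)) (γ κ)) →
      IsOptimalGMMPlan lam μ (mixture w γ)) ∧
    (∀ γs : Measure (Fin J → Rd d), IsOptimalGMMPlan lam μ γs →
      ∃ (w : (∀ j, Fin (K j)) → ℝ≥0) (γ : (∀ j, Fin (K j)) → Measure (Fin J → Rd d)),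
        IsOptimalTensor lam p comp w ∧
        (∀ κ, IsGMM (γ κ) ∧ IsOptimalPlan lam (fun j => comp j (κ j)) (γ κ)) ∧
        γs = mixture w γ) := by
  obtain rfl : μ = fun j => mixture (p j) (comp j) := funext hμ
  have hfin (κ : ∀ j, Fin (K j)) : mmW2sq lam (fun j => comp j (κ j)) ≠ ⊤ :=
    mmW2sq_ne_top_of_isGaussian hlam fun j => hcomp j (κ j)
  obtain ⟨w₀, hw₀⟩ := exists_isOptimalTensor hp hfin
  have hvalue := MMW2sq_eq_discreteCost hlam hp hcomp hw₀
  refine ⟨hvalue ▸ (discreteCost_ne_top hfin w₀).lt_top,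
    ⟨⟨w₀, hw₀.1, hvalue.symm⟩, ?_⟩, ?_, ?_, ?_⟩
  · exact Set.forall_mem_image.mpr fun _ hw => MMW2sq_le_discreteCost hlam hp hcomp hw
  · exact fun κ => exists_isGaussian_isOptimalPlan hlam fun j => hcomp j (κ j)
  · exact fun w γ hw hγ => isOptimalGMMPlan_mixture hlam hp hcomp hw hγ
  · exact fun γs hγs => exists_isOptimalTensor_of_isOptimalGMMPlan hlam hp hcomp hγs

theorem mainTheorem4 {J d : ℕ}
    (lam : Fin J → ℝ) (hlam : ∀ j, 0 ≤ lam j) (hlam_sum : ∑ j, lam j = 1)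
    (K : Fin J → ℕ)
    (p : ∀ j, Fin (K j) → ℝ≥0) (hp : ∀ j, ∑ k, p j k = 1)
    (comp : ∀ j, Fin (K j) → Measure (GMMOT.Rd d)) (hcomp : ∀ j k, IsGaussian (comp j k))
    (μ : Fin J → Measure (GMMOT.Rd d)) (hμ : ∀ j, μ j = GMMOT.mixture (p j) (comp j)) :
    -- the value is finite, and it is the minimum of the discrete linear program
    GMMOT.MMW2sq lam μ < ⊤ ∧
    IsLeast (GMMOT.discreteCost lam comp '' GMMOT.tensorCouplings p) (GMMOT.MMW2sq lam μ) ∧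
    -- each tuple of Gaussian components has a Gaussian optimal multi-marginal plan
    (∀ κ : ∀ j, Fin (K j), ∃ γ : Measure (Fin J → GMMOT.Rd d),
      IsGaussian γ ∧ GMMOT.IsOptimalPlan lam (fun j => comp j (κ j)) γ) ∧
    -- mixing Gaussian optimal plans with a solution of the linear program gives a solution
    (∀ (w : (∀ j, Fin (K j)) → ℝ≥0) (γ : (∀ j, Fin (K j)) → Measure (Fin J → GMMOT.Rd d)),
      GMMOT.IsOptimalTensor lam p comp w →
      (∀ κ, IsGaussian (γ κ) ∧ GMMOT.IsOptimalPlan lam (fun j => comp j (κ j)) (γ κ)) →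
      GMMOT.IsOptimalGMMPlan lam μ (GMMOT.mixture w γ)) ∧
    -- every solution is such a mixture of optimal plans
    (∀ γs : Measure (Fin J → GMMOT.Rd d), GMMOT.IsOptimalGMMPlan lam μ γs →
      ∃ (w : (∀ j, Fin (K j)) → ℝ≥0) (γ : (∀ j, Fin (K j)) → Measure (Fin J → GMMOT.Rd d)),
        GMMOT.IsOptimalTensor lam p comp w ∧
        (∀ κ, GMMOT.IsGMM (γ κ) ∧ GMMOT.IsOptimalPlan lam (fun j => comp j (κ j)) (γ κ)) ∧
        γs = GMMOT.mixture w γ) := by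
  have : NeZero J := ⟨by rintro rfl; simp at hlam_sum⟩
  exact mainTheorem4_general lam hlam K p hp comp hcomp μ hμ
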